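/- Let $K$ be a field, let $1\le m\le n$, and let $X=(x_{ij})$ be an $m\times n$ matrix whose entries are distinct indeterminates, with polynomial ring $K[X]=K[x_{ij}\mid 1\le i\le m,\ 1\le j\le n]$. Let $\mathcal G_m(X)$ be the set of maximal minors of $X$, i.e. of the determinants of the $m\times m$ submatrices of $X$ on columns $j_1<\dots<j_m$, and let $I_m(X)\subset K[X]$ be the ideal generated by $\mathcal G_m(X)$. Let $\sigma$ be a diagonal term order on $K[X]$, i.e. one for which the leading term of the determinant of each square submatrix of $X$ is the product of the indeterminates on the diagonal of that submatrix, and let $in(I_m(X))$ be the initial ideal of $I_m(X)$ with respect to $\sigma$, generated by the leading terms of all elements of $I_m(X)$. Then: 1. $\mathcal G_m(X)$ is a reduced Gröbner basis of $I_m(X)$ with respect to $\sigma$; 2. $in(I_m(X))$ is a squarefree monomial ideal, and it is Cohen–Macaulay, i.e. $K[X]/in(I_m(X))$ is a Cohen–Macaulay ring; 3. the simplicial complex $\Delta_X$ associated to $in(I_m(X))$, that is, the unique simplicial complex on the vertex set $\{(i,j)\mid 1\le i\le m,\ 1\le j\le n\}$ whose Stanley–Reisner ideal $\bigl(\prod_{(i,j)\in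 F}x_{ij} \mid F\notin\Delta_X\bigr)$ equals $in(I_m(X))$, is vertex decomposable. Here a simplicial complex is a collection of subsets (faces) closed under taking subsets, $\dim F=|F|-1$ for a face $F$, the dimension of a complex is the maximum of the dimensions of its faces, and a complex is pure if all its maximal faces have the same dimension. For a vertex $k$ of $\Delta$ (so $\{k\}\in\Delta$), put $\operatorname{lk}_k(\Delta)=\{G\in\Delta\mid k\notin G,\ G\cup\{k\}\in\Delta\}$ and $\Delta-k=\{G\in\Delta\mid k\notin G\}$. A complex $\Delta$ is vertex decomposable if it is a simplex (all subsets of some set of vertices, possibly the empty set of vertices), or it has no faces, or there is a vertex $k$ of $\Delta$ such that $\operatorname{lk}_k(\Delta)$ and $\Delta-k$ are both pure and vertex decomposable and $\dim\Delta=\dim(\Delta-k)=\dim\operatorname{lk}_k(\Delta)+1$. -/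

import Mathlib

noncomputable section

namespace MaxMinors

open MvPolynomial

/-! ### Simplicial complexes

A simplicial complex on a finite vertex set `V`, as a collection of subsets of `V` closed under
taking subsets (the empty face is allowed to be a face), is a `LowerSet (Finset V)`.
The complex with no face at all is `⊥`, and the simplex on `F` is `LowerSet.Iic F`. -/

section Complexes

variable {V : Type*} [DecidableEq V]

/-- A facet: a face that is maximal with respect to inclusion. -/
def IsFacet (Δ : LowerSet (Finset V)) (F : Finset V) : Prop :=
  Maximal (fun G => G ∈ Δ) F

/-- The dimension `|F| - 1` of a face. -/
def faceDim (F : Finset V) : WithBot ℤ := (((F.card : ℤ) - 1 : ℤ) : WithBot ℤ)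

open Classical in
/-- The dimension of a complex: the maximum of the dimensions of its faces
(`⊥` if there is no face, `-1` if the only face is the empty one). -/
def dim [Fintype V] (Δ : LowerSet (Finset V)) : WithBot ℤ :=
  (Finset.univ.filter (fun F => F ∈ Δ)).sup faceDim

/-- A complex is pure if each facet has the dimension of the complex. -/
def IsPure [Fintype V] (Δ : LowerSet (Finset V)) : Prop :=
  ∀ F, IsFacet Δ F → faceDim F = dim Δ

/-- The link of `F` in `Δ`. -/
def link (Δ : LowerSet (Finset V)) (F : Finset V) : LowerSet (Finset V) where
  carrier := {G | G ∈ Δ ∧ F ∪ G ∈ Δ ∧ Disjoint F G}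
  lower' := fun _ _ hle h =>
    ⟨Δ.lower hle h.1, Δ.lower (Finset.union_subset_union_right hle) h.2.1,
      h.2.2.mono_right hle⟩

/-- The deletion `Δ - F`. -/
def deletion (Δ : LowerSet (Finset V)) (F : Finset V) : LowerSet (Finset V) where
  carrier := {G | G ∈ Δ ∧ Disjoint F G}
  lower' := fun _ _ hle h => ⟨Δ.lower hle h.1, h.2.mono_right hle⟩

/-- Vertex decomposability. -/
inductive IsVertexDecomposable [Fintype V] : LowerSet (Finset V) → Prop
  | simplex (F : Finset V) : IsVertexDecomposable (LowerSet.Iic F)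
  | empty : IsVertexDecomposable ⊥
  | step (Δ : LowerSet (Finset V)) (k : V) (hk : {k} ∈ Δ)
      (link_pure : IsPure (link Δ {k})) (deletion_pure : IsPure (deletion Δ {k}))
      (link_vd : IsVertexDecomposable (link Δ {k}))
      (deletion_vd : IsVertexDecomposable (deletion Δ {k}))
      (dim_deletion : dim Δ = dim (deletion Δ {k}))
      (dim_link : dim Δ = dim (link Δ {k}) + 1) :
      IsVertexDecomposable Δ

end Complexes

/-! ### Squarefree monomial ideals -/

section Squarefree

variable {V : Type*} (K : Type*) [Field K]

/-- The squarefree monomial with support `F`. -/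
def sqfreeMonomial (F : Finset V) : MvPolynomial V K := ∏ i ∈ F, X i

/-- The Stanley-Reisner ideal of a complex: generated by the squarefree monomials of the
non-faces. -/
def stanleyReisnerIdeal (Δ : LowerSet (Finset V)) : Ideal (MvPolynomial V K) :=
  Ideal.span {p | ∃ F : Finset V, F ∉ Δ ∧ p = sqfreeMonomial K F}

variable {K}

/-- An ideal generated by squarefree monomials. -/
def IsSquarefreeMonomialIdeal (I : Ideal (MvPolynomial V K)) : Prop :=
  ∃ S : Set (Finset V), I = Ideal.span (sqfreeMonomial K '' S)

end Squarefree

/-! ### Cohen-Macaulay rings -/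

/-- A local ring that possesses a regular sequence in its maximal ideal whose length is the
Krull dimension of the ring. For a Noetherian local ring this says depth = dimension. -/
def IsCohenMacaulayLocal (R : Type*) [CommRing R] [IsLocalRing R] : Prop :=
  ∃ rs : List R, (∀ r ∈ rs, r ∈ IsLocalRing.maximalIdeal R) ∧
    RingTheory.Sequence.IsRegular R rs ∧ (rs.length : WithBot ℕ∞) = ringKrullDim R

/-- A Noetherian ring all of whose localizations at maximal ideals are Cohen-Macaulay. -/
def IsCohenMacaulayRing (R : Type*) [CommRing R] : Prop :=
  IsNoetherianRing R ∧
    ∀ (P : Ideal R) [P.IsMaximal], IsCohenMacaulayLocal (Localization.AtPrime P)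

/-- An ideal is called Cohen-Macaulay if its quotient ring is. -/
def IsCohenMacaulayIdeal {R : Type*} [CommRing R] (I : Ideal R) : Prop :=
  IsCohenMacaulayRing (R ⧸ I)

/-! ### Initial ideals and Gröbner bases -/

section Groebner

variable {V K : Type*} [Field K]

/-- The initial ideal of `I`, generated by the leading terms of all elements of `I`. -/
def initialIdeal (σ : MonomialOrder V) (I : Ideal (MvPolynomial V K)) :
    Ideal (MvPolynomial V K) :=
  Ideal.span (σ.leadingTerm '' (I : Set (MvPolynomial V K)))

/-- `G` is a Gröbner basis of `I`: a finite subset of `I` whose leading terms generate the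
initial ideal of `I`. -/
def IsGroebnerBasis (σ : MonomialOrder V) (G : Set (MvPolynomial V K))
    (I : Ideal (MvPolynomial V K)) : Prop :=
  G.Finite ∧ G ⊆ I ∧ Ideal.span (σ.leadingTerm '' G) = initialIdeal σ I

/-- `G` is a reduced Gröbner basis of `I`: each element is monic, and no monomial that occurs in
an element `g` lies in the ideal generated by the leading terms of the other elements. -/
def IsReducedGroebnerBasis (σ : MonomialOrder V) (G : Set (MvPolynomial V K))
    (I : Ideal (MvPolynomial V K)) : Prop :=
  IsGroebnerBasis σ G I ∧ ∀ g ∈ G, σ.Monic g ∧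
    ∀ d ∈ g.support, monomial d (1 : K) ∉ Ideal.span (σ.leadingTerm '' (G \ {g}))

end Groebner

/-! ### Minors of a generic matrix -/

section Minors

variable (m n : ℕ) (K : Type*) [Field K]

/-- The minor of the generic `m × n` matrix `(x_{ij})` on the rows `r 0 < r 1 < …` and the
columns `c 0 < c 1 < …`. -/
def minor {m n : ℕ} {k : ℕ} (r : Fin k ↪o Fin m) (c : Fin k ↪o Fin n) :
    MvPolynomial (Fin m × Fin n) K :=
  ((Matrix.mvPolynomialX (Fin m) (Fin n) K).submatrix r c).det

/-- The set of minors of size `t` of the generic `m × n` matrix. -/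
def minors (t : ℕ) : Set (MvPolynomial (Fin m × Fin n) K) :=
  {p | ∃ (r : Fin t ↪o Fin m) (c : Fin t ↪o Fin n), p = minor K r c}

/-- The ideal of minors of size `t` of the generic `m × n` matrix. -/
def minorsIdeal (t : ℕ) : Ideal (MvPolynomial (Fin m × Fin n) K) :=
  Ideal.span (minors m n K t)

variable {m n}

/-- A term order is diagonal if the leading term of the determinant of each square submatrix is
the product of the indeterminates on its diagonal. -/
def IsDiagonal (σ : MonomialOrder (Fin m × Fin n)) : Prop :=
  ∀ (k : ℕ) (r : Fin k ↪o Fin m) (c : Fin k ↪o Fin n),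
    σ.leadingTerm (minor K r c) = ∏ i : Fin k, X (r i, c i)

end Minors

end MaxMinors

end

/-! A chain in the upper left m × n block is a set of cells (0,c₀), …, (m-1,c_{m-1}) with c₀ < … <
c_{m-1} < n, the support of a diagonal term. `HasChain` is defined by recursion on the corner cell
(m-1,n-1), which a chain either avoids or ends in; all three parts of the theorem follow this
recursion.

Gröbner basis: elements of I_m vanish on matrices with dependent rows. Over an infinite field, a
polynomial with this property and no monomial divisible by a diagonal term is zero
(`eq_zero_of_vanishesOnDependent`). Indeed, sending the corner entry to infinity shows that the top
part in the corner variable vanishes whenever the rows of the (m-1) × (n-1) block are dependent, so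
by induction the corner variable does not occur; then the last column can be dropped. Hence division
of an element of I_m by the minors leaves remainder 0, and the initial ideal is the Stanley–Reisner
ideal of `chainComplex`.

Vertex decomposability: deletion and link of the corner are the chain complexes of the m × (n-1) and
(m-1) × (n-1) blocks, with the corner removed from the vertices. The same recursion counts the
elements of a facet, which gives purity and the dimensions.

Cohen–Macaulayness is proved directly: K[X]/in(I_m) is finite projective over a polynomial ring
whose variables act as differences along each full diagonal and as the variables off these
diagonals. With x the corner variable, 0 → S/(I:x) → S/I → S/(I+(x)) → 0 reduces this to quotients
by one variable from each full diagonal. A finite flat algebra over a polynomial ring over a field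
is Cohen–Macaulay (`isCohenMacaulayRing_of_finite_of_flat`). -/

noncomputable section
namespace MaxMinors
open MvPolynomial

/-! ### Chains of cells: supports of diagonal terms. -/

section Chains

variable {M N : ℕ}

/-- `F` contains cells `(0, c 0), …, (m - 1, c (m - 1))` with `c 0 < … < c (m - 1) < n`. -/
def HasChain (F : Finset (Fin M × Fin N)) : ℕ → ℕ → Prop
  | 0, _ => True
  | _ + 1, 0 => False
  | m + 1, n + 1 =>
    HasChain F (m + 1) n ∨ ((∃ v ∈ F, v.1.val = m ∧ v.2.val = n) ∧ HasChain F m n)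

theorem hasChain_zero (F : Finset (Fin M × Fin N)) (n : ℕ) : HasChain F 0 n := by
  cases n <;> simp [HasChain]

theorem not_hasChain_succ_zero (F : Finset (Fin M × Fin N)) (m : ℕ) : ¬ HasChain F (m + 1) 0 := by
  simp [HasChain]

theorem hasChain_succ (F : Finset (Fin M × Fin N)) (m n : ℕ) : HasChain F (m + 1) (n + 1) ↔
    HasChain F (m + 1) n ∨ ((∃ v ∈ F, v.1.val = m ∧ v.2.val = n) ∧ HasChain F m n) := by
  simp [HasChain]

theorem hasChain_succ_of_mem {F : Finset (Fin M × Fin N)} {i : Fin M} {j : Fin N} :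
    HasChain F (i + 1) (j + 1) ↔ HasChain F (i + 1) j ∨ ((i, j) ∈ F ∧ HasChain F i j) := by
  rw [hasChain_succ]
  constructor
  · rintro (h | ⟨⟨⟨i', j'⟩, hv, h1, h2⟩, h⟩)
    · exact .inl h
    · obtain rfl := Fin.ext h1
      obtain rfl := Fin.ext h2
      exact .inr ⟨hv, h⟩
  · rintro (h | ⟨hv, h⟩)
    · exact .inl h
    · exact .inr ⟨⟨_, hv, rfl, rfl⟩, h⟩

theorem HasChain.mono {F G : Finset (Fin M × Fin N)} (hFG : F ⊆ G) {m n : ℕ}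
    (h : HasChain F m n) : HasChain G m n := by
  induction n generalizing m with
  | zero => cases m with
    | zero => exact hasChain_zero _ _
    | succ m => exact absurd h (not_hasChain_succ_zero _ _)
  | succ n ih => cases m with
    | zero => exact hasChain_zero _ _
    | succ m =>
      rw [hasChain_succ] at h ⊢
      rcases h with h | ⟨⟨v, hv, hv'⟩, h⟩
      · exact .inl (ih h)
      · exact .inr ⟨⟨v, hFG hv, hv'⟩, ih h⟩

theorem HasChain.mono_right {F : Finset (Fin M × Fin N)} {m n n' : ℕ} (hn : n ≤ n')
    (h : HasChain F m n) : HasChain F m n' := by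
  induction n', hn using Nat.le_induction with
  | base => exact h
  | succ n' _ ih => cases m with
    | zero => exact hasChain_zero _ _
    | succ m => exact (hasChain_succ _ _ _).2 (.inl ih)

/-- Dropping the last cell of a chain. -/
theorem HasChain.pred {F : Finset (Fin M × Fin N)} {m n : ℕ} (h : HasChain F (m + 1) (n + 1)) :
    HasChain F m n := by
  induction n generalizing m with
  | zero =>
    rw [hasChain_succ] at h
    exact h.elim (fun h => absurd h (not_hasChain_succ_zero _ _)) (·.2)
  | succ n ih =>
    rw [hasChain_succ] at h
    exact h.elim (fun h => (ih h).mono_right n.le_succ) (·.2)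

theorem hasChain_iff_exists {F : Finset (Fin M × Fin N)} {m n : ℕ} :
    HasChain F m n ↔ ∃ c : ℕ → ℕ, (∀ i j, i < j → j < m → c i < c j) ∧
      ∀ i < m, c i < n ∧ ∃ v ∈ F, v.1.val = i ∧ v.2.val = c i := by
  induction n generalizing m with
  | zero => cases m with
    | zero => simp [hasChain_zero]
    | succ m =>
      simp only [not_hasChain_succ_zero, false_iff, not_exists, not_and]
      intro c _ h
      exact absurd (h 0 m.succ_pos).1 (Nat.not_lt_zero _)
  | succ n ih => cases m with
    | zero => simp [hasChain_zero]
    | succ m =>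
      rw [hasChain_succ, ih, ih]
      constructor
      · rintro (⟨c, hc, h⟩ | ⟨hv, c, hc, h⟩)
        · exact ⟨c, hc, fun i hi => ⟨Nat.lt_succ_of_lt (h i hi).1, (h i hi).2⟩⟩
        · refine ⟨fun i => if i = m then n else c i, fun i j hij hj => ?_, fun i hi => ?_⟩
          · rcases (Nat.lt_succ_iff.1 hj).eq_or_lt with rfl | hj'
            · simpa [hij.ne] using (h i hij).1
            · simpa [(hij.trans hj').ne, hj'.ne] using hc i j hij hj'
          · rcases (Nat.lt_succ_iff.1 hi).eq_or_lt with rfl | hi'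
            · simpa using hv
            · simp only [hi'.ne, if_false]
              exact ⟨Nat.lt_succ_of_lt (h i hi').1, (h i hi').2⟩
      · rintro ⟨c, hc, h⟩
        by_cases hcm : c m = n
        · right
          refine ⟨hcm ▸ (h m m.lt_succ_self).2, c, fun i j hij hj => hc i j hij (hj.trans m.lt_succ_self),
            fun i hi => ⟨?_, (h i (hi.trans m.lt_succ_self)).2⟩⟩
          exact hcm ▸ hc i m hi m.lt_succ_self
        · left
          refine ⟨c, hc, fun i hi => ⟨?_, (h i hi).2⟩⟩
          have hm : c m < n := lt_of_le_of_ne (Nat.lt_succ_iff.1 (h m m.lt_succ_self).1) hcm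
          rcases (Nat.lt_succ_iff.1 hi).eq_or_lt with rfl | hi'
          · exact hm
          · exact (hc i m hi' m.lt_succ_self).trans hm

end Chains

/-! ### Polynomials vanishing on matrices with dependent rows. -/

section Vanishing

variable {M N : ℕ} {L : Type*} [Field L]

/-- `l` is a nontrivial relation between the rows of the upper left `m × n` block of `a`. -/
def IsRowRelation (m n : ℕ) (a : Fin M × Fin N → L) (l : Fin M → L) : Prop :=
  l ≠ 0 ∧ (∀ i : Fin M, m ≤ i → l i = 0) ∧ ∀ j : Fin N, j.val < n → ∑ i, l i * a (i, j) = 0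

/-- `f` vanishes wherever the rows of the upper left `m × n` block are dependent. -/
def VanishesOnDependent (m n : ℕ) (f : MvPolynomial (Fin M × Fin N) L) : Prop :=
  ∀ a l, IsRowRelation m n a l → eval a f = 0

variable [Infinite L]

theorem eval_zero_eq_zero_of_forall_ne {h : Polynomial L} (hh : ∀ s, s ≠ 0 → h.eval s = 0) :
    h.eval 0 = 0 := by
  have : h = 0 := by
    refine Polynomial.eq_zero_of_infinite_isRoot h ?_
    refine Set.Infinite.mono (s := {0}ᶜ) (fun s hs => hh s hs) ?_
    exact (Set.finite_singleton (0 : L)).infinite_compl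
  simp [this]

/-- The part of `f` of top degree in the variable `k`. -/
def topPart {V : Type*} (k : V) (f : MvPolynomial V L) : MvPolynomial V L :=
  ∑ d ∈ f.support with d k = degreeOf k f, monomial d (coeff d f)

omit [Infinite L] in
theorem coeff_topPart {V : Type*} (k : V) (f : MvPolynomial V L) (d : V →₀ ℕ) :
    coeff d (topPart k f) = if d k = degreeOf k f then coeff d f else 0 := by
  classical
  simp only [topPart, coeff_sum, coeff_monomial, Finset.sum_ite_eq', Finset.mem_filter,
    mem_support_iff]
  split_ifs <;> simp_all

/-- Degeneration: a dependent i × j block extends to a family of dependent (i+1) × (j+1) blocks with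
corner entry s⁻¹. After scaling by s^D, the value of `f` tends to that of its top part as s → 0, up
to a power of the corner entry. -/
theorem vanishesOnDependent_topPart {i : Fin M} {j : Fin N} {f : MvPolynomial (Fin M × Fin N) L}
    (hf : VanishesOnDependent (i + 1) (j + 1) f) :
    VanishesOnDependent i j (topPart (i, j) f) := by
  classical
  intro a l hl
  set k := (i, j) with hk
  set D := degreeOf k f with hD
  -- A Schur complement: with s⁻¹ in the corner, eliminating column j from the rows above i turns
  -- these entries back into those of `a`.
  let B : Fin M × Fin N → Polynomial L := fun v =>
    if v.2 = j then .C (a v) else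
      if v.1 < i then .C (a v) + .X * .C (a (v.1, j) * a (i, v.2)) else .C (a v)
  -- For s ≠ 0 this is s^D times the value of `f` on the family; at s = 0 only the terms with d k =
  -- D survive.
  let h : Polynomial L := ∑ d ∈ f.support,
    .C (coeff d f) * .X ^ (D - d k) * ∏ v ∈ Finset.univ.erase k, B v ^ d v
  have hle : ∀ d ∈ f.support, d k ≤ D := fun d hd => by
    rw [hD, degreeOf_eq_sup]
    exact Finset.le_sup (f := fun d : (Fin M × Fin N) →₀ ℕ => d k) hd
  have h0 : h.eval 0 = 0 := by
    refine eval_zero_eq_zero_of_forall_ne fun s hs => ?_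
    let b : Fin M × Fin N → L := fun v => if v = k then s⁻¹ else (B v).eval s
    have hb : h.eval s = s ^ D * eval b f := by
      rw [eval_eq', Finset.mul_sum, Polynomial.eval_finsetSum]
      refine Finset.sum_congr rfl fun d hd => ?_
      rw [← Finset.mul_prod_erase Finset.univ _ (Finset.mem_univ k)]
      have e1 : ∏ v ∈ Finset.univ.erase k, b v ^ d v =
          ∏ v ∈ Finset.univ.erase k, (B v).eval s ^ d v :=
        Finset.prod_congr rfl fun v hv => by simp [b, Finset.ne_of_mem_erase hv]
      have e2 : s ^ D = s ^ (D - d k) * s ^ d k := by rw [← pow_add, Nat.sub_add_cancel (hle d hd)]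
      have e3 : b k = s⁻¹ := by simp [b]
      rw [e1, e2, e3, Polynomial.eval_mul, Polynomial.eval_mul, Polynomial.eval_prod]
      simp only [Polynomial.eval_C, Polynomial.eval_pow, Polynomial.eval_X, inv_pow]
      field_simp
    rw [hb]
    let c : L := ∑ i', l i' * a (i', j)
    have hli : l i = 0 := hl.2.1 i le_rfl
    -- The coefficient -(s * c) of row i is forced by column j: times s⁻¹ it cancels c.
    have hrel : IsRowRelation (i + 1) (j + 1) b (fun i' => if i' = i then -(s * c) else l i') := by
      refine ⟨fun h0 => hl.1 ?_, fun i' hi' => ?_, fun j' hj' => ?_⟩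
      · ext i'
        have := congrFun h0 i'
        by_cases hi : i' = i
        · simp [hi, hli]
        · simpa [hi] using this
      · have h1 : i' ≠ i := by rintro rfl; omega
        simpa [h1] using hl.2.1 i' (by omega)
      · rw [← Finset.add_sum_erase _ _ (Finset.mem_univ i)]
        have hlt : ∀ i' ∈ Finset.univ.erase i, l i' ≠ 0 → i' < i := fun i' hi' h0 => by
          by_contra hlt
          exact h0 (hl.2.1 i' (by simpa using hlt))
        by_cases hjj : j' = j
        · subst hjj
          have : ∑ x ∈ Finset.univ.erase i, (if x = i then -(s * c) else l x) * b (x, j') = c := by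
            simp only [c]
            rw [← Finset.add_sum_erase _ _ (Finset.mem_univ i), hli, zero_mul, zero_add]
            refine Finset.sum_congr rfl fun x hx => ?_
            have := Finset.ne_of_mem_erase hx
            simp [this, b, B, hk]
          rw [this]
          simp [b, hk]
          field_simp
          ring
        · have hjlt : j'.val < j := by
            have : j'.val ≠ j := fun h => hjj (Fin.ext h)
            omega
          have : ∑ x ∈ Finset.univ.erase i, (if x = i then -(s * c) else l x) * b (x, j')
              = s * a (i, j') * c := by
            have h1 := hl.2.2 j' hjlt
            rw [← Finset.add_sum_erase _ _ (Finset.mem_univ i), hli, zero_mul, zero_add] at h1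
            have hc : c = ∑ x ∈ Finset.univ.erase i, l x * a (x, j) := by
              simp only [c]
              rw [← Finset.add_sum_erase _ _ (Finset.mem_univ i), hli, zero_mul, zero_add]
            rw [hc, ← zero_add (s * a (i, j') * _), ← h1,
              Finset.mul_sum _ _ (s * a (i, j')), ← Finset.sum_add_distrib]
            refine Finset.sum_congr rfl fun x hx => ?_
            have hx' := Finset.ne_of_mem_erase hx
            by_cases hlx : l x = 0
            · simp [hx', hlx]
            · simp [hx', b, B, hk, hjj, hlt x hx hlx]
              ring
          rw [this]
          simp [b, B, hk, hjj]
          ring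
    rw [hf b _ hrel, mul_zero]
  have hB0 : ∀ v, (B v).eval 0 = a v := fun v => by
    simp only [B]; split_ifs <;> simp
  have : eval a (topPart k f) = a k ^ D * h.eval 0 := by
    simp only [topPart, map_sum, h, Polynomial.eval_finsetSum, Polynomial.eval_mul,
      Polynomial.eval_prod, Polynomial.eval_pow, Polynomial.eval_C, Polynomial.eval_X, hB0,
      Finset.mul_sum, Finset.sum_filter]
    refine Finset.sum_congr rfl fun d hd => ?_
    split_ifs with hdk
    · rw [eval_monomial, Finsupp.prod_fintype _ _ (by simp), ← Finset.mul_prod_erase _ _ (Finset.mem_univ k)]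
      simp only [← hD, hdk]
      simp
      ring
    · have : D - d k ≠ 0 := by have := hle d hd; omega
      simp [zero_pow this]
  rw [this, h0, mul_zero]

omit [Infinite L] in
theorem eval_update_of_degreeOf_eq_zero {V : Type*} [DecidableEq V] {k : V} {f : MvPolynomial V L}
    (hf : degreeOf k f = 0) (a : V → L) (x : L) : eval (Function.update a k x) f = eval a f := by
  refine eval₂Hom_congr' rfl (fun i hi _ => ?_) rfl
  have : i ≠ k := by
    rintro rfl
    rw [degreeOf_eq_sup] at hf
    obtain ⟨d, hd, hi⟩ := (mem_vars_iff_mem_support i).1 hi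
    have := Finset.le_sup (f := fun d : V →₀ ℕ => d i) hd
    exact Finsupp.mem_support_iff.1 hi (by omega)
  simp [this]

/-- Since the corner variable does not occur, its value may be chosen so that a relation on the
first j columns also holds on column j. This needs a nonzero coefficient at row i; the general case
is a limit of this one. -/
theorem vanishesOnDependent_of_degreeOf_eq_zero {i : Fin M} {j : Fin N}
    {f : MvPolynomial (Fin M × Fin N) L} (hf : VanishesOnDependent (i + 1) (j + 1) f)
    (hd : degreeOf (i, j) f = 0) : VanishesOnDependent (i + 1) j f := by
  classical
  have key : ∀ a l, IsRowRelation (i + 1) j a l → l i ≠ 0 → eval a f = 0 := by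
    intro a l hl hli
    rw [← eval_update_of_degreeOf_eq_zero hd a
      (-(∑ i' ∈ Finset.univ.erase i, l i' * a (i', j)) / l i)]
    refine hf _ l ⟨hl.1, hl.2.1, fun j' hj' => ?_⟩
    rw [← Finset.add_sum_erase _ _ (Finset.mem_univ i)]
    by_cases hjj : j' = j
    · subst hjj
      have : ∀ x ∈ Finset.univ.erase i, l x * Function.update a (i, j')
          (-(∑ i' ∈ Finset.univ.erase i, l i' * a (i', j')) / l i) (x, j') = l x * a (x, j') :=
        fun x hx => by
          rw [Function.update_of_ne]
          exact fun h => Finset.ne_of_mem_erase hx (congrArg Prod.fst h)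
      rw [Finset.sum_congr rfl this]
      simp only [Function.update_self]
      field_simp
      ring
    · have hjlt : j'.val < j := by
        have : j'.val ≠ j := fun h => hjj (Fin.ext h)
        omega
      have hne : ∀ x, (x, j') ≠ (i, j) := fun x h => hjj (congrArg Prod.snd h)
      simp only [Function.update_of_ne (hne _)]
      rw [Finset.add_sum_erase _ (fun x => l x * a (x, j')) (Finset.mem_univ i)]
      exact hl.2.2 j' hjlt
  intro a l hl
  by_cases hli : l i = 0
  · obtain ⟨i₀, hi₀⟩ := Function.ne_iff.1 hl.1
    have hi₀ : l i₀ ≠ 0 := hi₀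
    have hne : i ≠ i₀ := by rintro rfl; exact hi₀ hli
    -- Give row i the coefficient s and compensate in row i₀, whose coefficient is nonzero; s = 0
    -- recovers `a`.
    let B : Fin M × Fin N → Polynomial L := fun v =>
      if v.1 = i₀ then .C (a v) - .X * .C (a (i, v.2) / l i₀) else .C (a v)
    have hB : ∀ s, (aeval B f).eval s = eval (fun v => (B v).eval s) f := fun s => by
      rw [← Polynomial.coe_evalRingHom, aeval_def, eval₂_comp_left, eval, coe_eval₂Hom]
      congr 1
      ext
      simp
    have h0 : (aeval B f).eval 0 = 0 := by
      refine eval_zero_eq_zero_of_forall_ne fun s hs => ?_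
      rw [hB]
      refine key _ (Function.update l i s) ⟨fun h => hs ?_, fun i' hi' => ?_, fun j' hj' => ?_⟩ ?_
      · simpa using congrFun h i
      · rw [Function.update_of_ne (by rintro rfl; omega)]
        exact hl.2.1 i' hi'
      · have h1 := hl.2.2 j' hj'
        have hi₀' : i₀ ∈ Finset.univ.erase i := by simp [hne.symm]
        rw [← Finset.add_sum_erase _ _ (Finset.mem_univ i), hli, zero_mul, zero_add,
          ← Finset.add_sum_erase _ _ hi₀'] at h1
        rw [← Finset.add_sum_erase _ _ (Finset.mem_univ i), ← Finset.add_sum_erase _ _ hi₀']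
        have : ∀ x ∈ (Finset.univ.erase i).erase i₀,
            Function.update l i s x * (B (x, j')).eval s = l x * a (x, j') := fun x hx => by
          simp only [Finset.mem_erase, Finset.mem_univ, and_true] at hx
          simp [B, hx.1, hx.2]
        rw [Finset.sum_congr rfl this, eq_neg_of_add_eq_zero_right h1]
        simp [B, hne, hne.symm]
        field_simp
        ring
      · simpa using hs
    rw [hB] at h0
    have : (fun v => (B v).eval 0) = a := by
      funext v
      simp only [B]; split_ifs <;> simp
    rwa [this] at h0
  · exact key a l hl hli

/-- A polynomial without monomials that are divisible by a diagonal, and that vanishes on the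
matrices with dependent rows, is zero. -/
theorem eq_zero_of_vanishesOnDependent {m n : ℕ} (hm : m ≤ M) (hn : n ≤ N)
    {f : MvPolynomial (Fin M × Fin N) L} (hf : VanishesOnDependent m n f)
    (hs : ∀ d ∈ f.support, ¬ HasChain d.support m n) : f = 0 := by
  classical
  have zero_case : ∀ (n : ℕ) (f : MvPolynomial (Fin M × Fin N) L),
      (∀ d ∈ f.support, ¬ HasChain d.support 0 n) → f = 0 := fun n f hs =>
    support_eq_empty.1 (Finset.eq_empty_of_forall_notMem fun d hd => hs d hd (hasChain_zero _ _))
  induction n generalizing m f with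
  | zero => cases m with
    | zero => exact zero_case _ _ hs
    | succ m =>
      -- With no columns every nonzero `l` supported on the first m + 1 rows is a relation, so `f`
      -- vanishes at every point.
      refine MvPolynomial.funext fun a => ?_
      rw [map_zero]
      refine hf a (Pi.single ⟨0, by omega⟩ 1) ⟨by simp, fun i hi => ?_, fun j hj => by omega⟩
      have : i ≠ ⟨0, by omega⟩ := by
        intro h
        rw [h] at hi
        simp at hi
      simp [this]
  | succ n ih => cases m with
    | zero => exact zero_case _ _ hs
    | succ m =>
      let i : Fin M := ⟨m, hm⟩
      let j : Fin N := ⟨n, hn⟩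
      have hdeg : degreeOf (i, j) f = 0 := by
        by_contra hD
        have htop : topPart (i, j) f = 0 := by
          refine ih (m := m) (by omega) (by omega) (vanishesOnDependent_topPart (i := i) (j := j) hf)
            fun d hd hc => ?_
          rw [mem_support_iff, coeff_topPart] at hd
          split_ifs at hd with hdk
          · refine hs d (mem_support_iff.2 hd)
              ((hasChain_succ _ _ _).2 (.inr ⟨⟨(i, j), ?_, rfl, rfl⟩, hc⟩))
            rw [Finsupp.mem_support_iff, hdk]
            exact hD
          · exact hd rfl
        have hne : f.support.Nonempty := by
          rw [Finset.nonempty_iff_ne_empty, Ne, support_eq_empty]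
          rintro rfl
          simp at hD
        obtain ⟨d, hd, hdk⟩ := Finset.exists_mem_eq_sup f.support hne
          (fun d : (Fin M × Fin N) →₀ ℕ => d (i, j))
        have := coeff_topPart (i, j) f d
        rw [htop, degreeOf_eq_sup, ← hdk, if_pos rfl, coeff_zero] at this
        exact mem_support_iff.1 hd this.symm
      exact ih hm (by omega) (vanishesOnDependent_of_degreeOf_eq_zero (i := i) (j := j) hf hdeg)
        fun d hd hc => hs d hd ((hasChain_succ _ _ _).2 (.inl hc))

end Vanishing

/-! ### Stanley–Reisner ideals and their monomials. -/

section StanleyReisner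

variable {V K : Type*} [Field K]

theorem sqfreeMonomial_eq_monomial (F : Finset V) :
    sqfreeMonomial K F = monomial (∑ i ∈ F, Finsupp.single i 1) (1 : K) := by
  rw [monomial_sum_one]
  rfl

theorem sum_single_one_apply [DecidableEq V] (F : Finset V) (i : V) :
    (∑ j ∈ F, Finsupp.single j 1 : V →₀ ℕ) i = if i ∈ F then 1 else 0 := by
  simp [Finsupp.finsetSum_apply, Finsupp.single_apply]

theorem sum_single_one_le_iff (F : Finset V) (d : V →₀ ℕ) :
    ∑ i ∈ F, Finsupp.single i 1 ≤ d ↔ F ⊆ d.support := by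
  classical
  constructor
  · intro h i hi
    have := h i
    rw [sum_single_one_apply, if_pos hi] at this
    exact Finsupp.mem_support_iff.2 (by omega)
  · intro h i
    rw [sum_single_one_apply]
    split_ifs with hi
    · exact Nat.one_le_iff_ne_zero.2 (Finsupp.mem_support_iff.1 (h hi))
    · exact Nat.zero_le _

theorem support_sum_single_one (F : Finset V) :
    (∑ i ∈ F, Finsupp.single i 1 : V →₀ ℕ).support = F := by
  classical
  ext i
  simp [sum_single_one_apply]

theorem stanleyReisnerIdeal_eq_span_image (Δ : LowerSet (Finset V)) :
    stanleyReisnerIdeal K Δ = Ideal.span (sqfreeMonomial K '' {F | F ∉ Δ}) := by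
  refine congrArg Ideal.span (Set.ext fun p => ?_)
  simp only [Set.mem_ofPred_eq, Set.mem_image, eq_comm]

theorem mem_stanleyReisnerIdeal {Δ : LowerSet (Finset V)} {f : MvPolynomial V K} :
    f ∈ stanleyReisnerIdeal K Δ ↔ ∀ d ∈ f.support, d.support ∉ Δ := by
  have : stanleyReisnerIdeal K Δ = Ideal.span ((fun s => monomial s (1 : K)) ''
      ((fun F : Finset V => ∑ i ∈ F, Finsupp.single i 1) '' {F | F ∉ Δ})) := by
    rw [stanleyReisnerIdeal_eq_span_image, Set.image_image]
    simp only [sqfreeMonomial_eq_monomial]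
  rw [this, mem_ideal_span_monomial_image]
  refine forall₂_congr fun d _ => ⟨?_, fun h => ?_⟩
  · rintro ⟨_, ⟨F, hF, rfl⟩, hle⟩ hd
    exact hF (Δ.lower ((sum_single_one_le_iff F d).1 hle) hd)
  · exact ⟨_, ⟨d.support, h, rfl⟩, (sum_single_one_le_iff _ d).2 subset_rfl⟩

theorem sqfreeMonomial_mem_stanleyReisnerIdeal {Δ : LowerSet (Finset V)} {F : Finset V} :
    sqfreeMonomial K F ∈ stanleyReisnerIdeal K Δ ↔ F ∉ Δ := by
  classical
  rw [mem_stanleyReisnerIdeal, sqfreeMonomial_eq_monomial, support_monomial, if_neg one_ne_zero]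
  simp [support_sum_single_one]

theorem stanleyReisnerIdeal_injective :
    Function.Injective (stanleyReisnerIdeal (V := V) K) := fun Δ Δ' h => by
  ext F
  rw [← not_iff_not]
  change F ∉ Δ ↔ F ∉ Δ'
  rw [← sqfreeMonomial_mem_stanleyReisnerIdeal (K := K), h, sqfreeMonomial_mem_stanleyReisnerIdeal]

end StanleyReisner

/-- The complex of the subsets of `W` without a chain in the upper left `m × n` block. -/
def chainComplex {M N : ℕ} (W : Finset (Fin M × Fin N)) (m n : ℕ) :
    LowerSet (Finset (Fin M × Fin N)) where
  carrier := {F | F ⊆ W ∧ ¬ HasChain F m n}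
  lower' := fun _ _ hle h => ⟨hle.trans h.1, fun hc => h.2 (hc.mono hle)⟩

theorem mem_chainComplex {M N : ℕ} {W F : Finset (Fin M × Fin N)} {m n : ℕ} :
    F ∈ chainComplex W m n ↔ F ⊆ W ∧ ¬ HasChain F m n := Iff.rfl

/-! ### The Gröbner basis and the initial ideal. -/

section MaximalMinors

variable {m n : ℕ}

theorem hasChain_iff_exists_orderEmbedding {F : Finset (Fin m × Fin n)} :
    HasChain F m n ↔ ∃ c : Fin m ↪o Fin n, ∀ i, (i, c i) ∈ F := by
  rw [hasChain_iff_exists]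
  constructor
  · rintro ⟨c, hc, h⟩
    refine ⟨OrderEmbedding.ofStrictMono (fun i => ⟨c i, (h i i.2).1⟩)
      fun i j hij => hc i j hij j.2, fun i => ?_⟩
    obtain ⟨⟨i', j'⟩, hv, h1, h2⟩ := (h i i.2).2
    obtain rfl := Fin.ext h1
    convert hv
    exact Fin.ext h2.symm
  · rintro ⟨c, hc⟩
    refine ⟨fun i => if h : i < m then c ⟨i, h⟩ else 0, fun i j hij hj => ?_, fun i hi => ?_⟩
    · simpa [hj, hij.trans hj] using hij
    · simp only [hi, dif_pos]
      exact ⟨(c ⟨i, hi⟩).2, _, hc ⟨i, hi⟩, rfl, rfl⟩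

/-- The exponent of the diagonal term on the columns `c`. -/
def diagExponent (c : Fin m ↪o Fin n) : Fin m × Fin n →₀ ℕ :=
  ∑ i, Finsupp.single (i, c i) 1

theorem diagExponent_le_iff (c : Fin m ↪o Fin n) (d : Fin m × Fin n →₀ ℕ) :
    diagExponent c ≤ d ↔ ∀ i, (i, c i) ∈ d.support := by
  classical
  have : diagExponent c = ∑ v ∈ Finset.univ.image fun i => (i, c i), Finsupp.single v 1 := by
    rw [Finset.sum_image fun i _ j _ h => congrArg Prod.fst h]
    rfl
  rw [this, sum_single_one_le_iff]
  simp [Finset.image_subset_iff]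

variable (K : Type*) [Field K]

/-- The maximal minor on the columns `c`. -/
abbrev maxMinor (c : Fin m ↪o Fin n) : MvPolynomial (Fin m × Fin n) K :=
  minor K (RelEmbedding.refl _) c

theorem minors_eq_range : minors m n K m = Set.range (maxMinor K) := by
  ext p
  constructor
  · rintro ⟨r, c, rfl⟩
    have hr : (r : Fin m → Fin m) = id := by
      refine (StrictMono.range_inj r.strictMono strictMono_id).1 ?_
      rw [(Finite.injective_iff_surjective.1 r.injective).range_eq, Set.range_id]
    obtain rfl : r = RelEmbedding.refl _ := DFunLike.ext _ _ fun i => congrFun hr i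
    exact ⟨c, rfl⟩
  · rintro ⟨c, rfl⟩
    exact ⟨_, c, rfl⟩

theorem exists_perm_of_mem_support_maxMinor {c : Fin m ↪o Fin n} {d : Fin m × Fin n →₀ ℕ}
    (hd : d ∈ (maxMinor K c).support) :
    ∃ π : Equiv.Perm (Fin m), d = ∑ i, Finsupp.single (π i, c i) 1 := by
  classical
  rw [mem_support_iff, maxMinor, minor, Matrix.det_apply, coeff_sum] at hd
  obtain ⟨π, -, hπ⟩ := Finset.exists_ne_zero_of_sum_ne_zero hd
  refine ⟨π, ?_⟩
  by_contra hne
  apply hπ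
  have : ∏ i, ((Matrix.mvPolynomialX (Fin m) (Fin n) K).submatrix
      (RelEmbedding.refl (· ≤ ·)) c) (π i) i
        = monomial (∑ i, Finsupp.single (π i, c i) 1) (1 : K) := by
    rw [monomial_sum_one]
    rfl
  rw [this, coeff_smul, coeff_monomial, if_neg (Ne.symm hne), smul_zero]

/-- Every monomial of a maximal minor uses each of its columns once, so a diagonal term dividing it
has the same column set. This makes the Gröbner basis reduced. -/
theorem eq_of_diagExponent_le_of_mem_support {c c' : Fin m ↪o Fin n} {d : Fin m × Fin n →₀ ℕ}
    (hd : d ∈ (maxMinor K c).support) (hle : diagExponent c' ≤ d) : c' = c := by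
  classical
  obtain ⟨π, rfl⟩ := exists_perm_of_mem_support_maxMinor K hd
  rw [diagExponent_le_iff] at hle
  have h : ∀ i, c' i = c (π.symm i) := fun i => by
    have := hle i
    rw [Finsupp.mem_support_iff, Finsupp.finsetSum_apply] at this
    obtain ⟨k, -, hk⟩ := Finset.exists_ne_zero_of_sum_ne_zero this
    rw [Finsupp.single_apply, ite_ne_right_iff, Prod.mk.injEq] at hk
    rw [← hk.1.2, ← hk.1.1, Equiv.symm_apply_apply]
  refine DFunLike.coe_injective ((StrictMono.range_inj c'.strictMono c.strictMono).1 ?_)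
  have : (c' : Fin m → Fin n) = c ∘ π.symm := funext h
  rw [this, EquivLike.range_comp]

variable {K}

theorem vanishesOnDependent_of_mem_minorsIdeal {L : Type*} [Field L] [Algebra K L]
    {f : MvPolynomial (Fin m × Fin n) K} (hf : f ∈ minorsIdeal m n K m) :
    VanishesOnDependent m n (map (algebraMap K L) f) := by
  intro a l hl
  rw [eval_map]
  have hle : minorsIdeal m n K m ≤ RingHom.ker (eval₂Hom (algebraMap K L) a) := by
    rw [minorsIdeal, minors_eq_range, Ideal.span_le]
    rintro _ ⟨c, rfl⟩
    rw [SetLike.mem_coe, RingHom.mem_ker, maxMinor, minor, RingHom.map_det,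
      ← Matrix.exists_vecMul_eq_zero_iff]
    refine ⟨l, hl.1, funext fun j => ?_⟩
    simpa [Matrix.vecMul, dotProduct] using hl.2.2 (c j) (c j).2
  exact hle hf

/-- The monomials not divisible by a diagonal term are linearly independent modulo the ideal of
maximal minors. -/
theorem eq_zero_of_mem_minorsIdeal {f : MvPolynomial (Fin m × Fin n) K}
    (hf : f ∈ minorsIdeal m n K m) (hs : ∀ d ∈ f.support, ¬ HasChain d.support m n) : f = 0 := by
  -- `K` may be finite, whereas the vanishing argument needs infinitely many values.
  let L := AlgebraicClosure K
  have hinj := (algebraMap K L).injective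
  have : Infinite L := IsAlgClosed.instInfinite
  refine map_injective _ hinj ?_
  rw [map_zero]
  refine eq_zero_of_vanishesOnDependent le_rfl le_rfl
    (vanishesOnDependent_of_mem_minorsIdeal (L := L) hf) fun d hd => hs d ?_
  rwa [support_map_of_injective _ hinj] at hd

variable {σ : MonomialOrder (Fin m × Fin n)} (hσ : IsDiagonal K σ)
include hσ

theorem leadingTerm_maxMinor (c : Fin m ↪o Fin n) :
    σ.leadingTerm (maxMinor K c) = monomial (diagExponent c) 1 := by
  rw [hσ, diagExponent, monomial_sum_one]
  rfl

theorem degree_maxMinor_and_monic (c : Fin m ↪o Fin n) :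
    σ.degree (maxMinor K c) = diagExponent c ∧ σ.Monic (maxMinor K c) := by
  have := leadingTerm_maxMinor hσ c
  rw [MonomialOrder.leadingTerm, monomial_eq_monomial_iff] at this
  simpa [MonomialOrder.Monic] using this

/-- Division by the minors leaves remainder zero, by independence of the chain-free monomials. The
degree bounds on the summands then force the leading monomial of `f` to be that of some summand, a
multiple of a diagonal term. -/
theorem hasChain_degree_of_mem_minorsIdeal {f : MvPolynomial (Fin m × Fin n) K}
    (hf : f ∈ minorsIdeal m n K m) (h0 : f ≠ 0) : HasChain (σ.degree f).support m n := by
  obtain ⟨g, r, hfr, hdeg, hr⟩ := σ.div (b := maxMinor (n := n) (m := m) K)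
    (fun c => by rw [(degree_maxMinor_and_monic hσ c).2]; exact isUnit_one) f
  have hr0 : r = 0 := by
    refine eq_zero_of_mem_minorsIdeal ?_ fun d hd hc => ?_
    · rw [eq_sub_of_add_eq' hfr.symm]
      refine sub_mem hf ?_
      rw [Finsupp.linearCombination_apply]
      refine sum_mem fun c _ => Ideal.mul_mem_left _ _ (Ideal.subset_span ?_)
      rw [minors_eq_range]
      exact ⟨c, rfl⟩
    · obtain ⟨c, hc⟩ := hasChain_iff_exists_orderEmbedding.1 hc
      refine hr d hd c ?_
      rw [(degree_maxMinor_and_monic hσ c).1, diagExponent_le_iff]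
      exact hc
  rw [hr0, add_zero, Finsupp.linearCombination_apply] at hfr
  have hlc : coeff (σ.degree f) f ≠ 0 := σ.coeff_degree_ne_zero_iff.2 h0
  conv at hlc => enter [1, 2]; rw [hfr]
  rw [Finsupp.sum, coeff_sum] at hlc
  obtain ⟨c, -, hc⟩ := Finset.exists_ne_zero_of_sum_ne_zero hlc
  rw [smul_eq_mul, mul_comm] at hc
  have hne : maxMinor K c * g c ≠ 0 := by
    intro h
    rw [h] at hc
    simp at hc
  have heq : σ.degree (maxMinor K c * g c) = σ.degree f :=
    σ.toSyn.injective (le_antisymm (hdeg c) (σ.le_degree (mem_support_iff.2 hc)))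
  rw [hasChain_iff_exists_orderEmbedding]
  refine ⟨c, (diagExponent_le_iff c _).1 ?_⟩
  rw [← heq, σ.degree_mul (left_ne_zero_of_mul hne) (right_ne_zero_of_mul hne),
    (degree_maxMinor_and_monic hσ c).1]
  exact le_self_add

theorem image_leadingTerm_maxMinor (S : Set (Fin m ↪o Fin n)) :
    σ.leadingTerm '' (maxMinor K '' S) = (fun d => monomial d (1 : K)) '' (diagExponent '' S) := by
  simp only [Set.image_image, leadingTerm_maxMinor hσ]

theorem span_leadingTerm_minors : Ideal.span (σ.leadingTerm '' minors m n K m) =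
    stanleyReisnerIdeal K (chainComplex Finset.univ m n) := by
  ext f
  rw [minors_eq_range, ← Set.image_univ, image_leadingTerm_maxMinor hσ,
    mem_ideal_span_monomial_image, mem_stanleyReisnerIdeal]
  simp [mem_chainComplex, hasChain_iff_exists_orderEmbedding, diagExponent_le_iff]

theorem initialIdeal_minorsIdeal : initialIdeal σ (minorsIdeal m n K m) =
    stanleyReisnerIdeal K (chainComplex Finset.univ m n) := by
  classical
  refine le_antisymm (Ideal.span_le.2 ?_) ?_
  · rintro _ ⟨f, hf, rfl⟩
    rw [SetLike.mem_coe, mem_stanleyReisnerIdeal]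
    intro d hd
    by_cases h0 : f = 0
    · simp [h0] at hd
    · rw [σ.support_leadingTerm' h0, Finset.mem_singleton] at hd
      rw [hd, mem_chainComplex]
      exact fun h => h.2 (hasChain_degree_of_mem_minorsIdeal hσ hf h0)
  · rw [← span_leadingTerm_minors hσ]
    exact Ideal.span_mono (Set.image_mono Ideal.subset_span)

theorem isReducedGroebnerBasis_minors :
    IsReducedGroebnerBasis σ (minors m n K m) (minorsIdeal m n K m) := by
  refine ⟨⟨?_, Ideal.subset_span, ?_⟩, fun g hg => ?_⟩
  · rw [minors_eq_range]
    exact Set.finite_range _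
  · rw [span_leadingTerm_minors hσ, initialIdeal_minorsIdeal hσ]
  · rw [minors_eq_range] at hg ⊢
    obtain ⟨c, rfl⟩ := hg
    refine ⟨(degree_maxMinor_and_monic hσ c).2, fun d hd hmem => ?_⟩
    have hsub : Set.range (maxMinor K) \ {maxMinor K c} ⊆ maxMinor K '' {c' | c' ≠ c} := by
      rintro _ ⟨⟨c', rfl⟩, hne⟩
      exact ⟨c', fun h => hne (by rw [h]; rfl), rfl⟩
    replace hmem := Ideal.span_mono (Set.image_mono hsub) hmem
    rw [image_leadingTerm_maxMinor hσ, mem_ideal_span_monomial_image] at hmem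
    obtain ⟨_, ⟨c', hc', rfl⟩, hle⟩ := hmem d (by classical simp [support_monomial])
    exact hc' (eq_of_diagExponent_le_of_mem_support K hd hle)

end MaximalMinors

/-! ### Facets, purity and dimension. -/

section Facets

variable {V : Type*} [DecidableEq V] {Δ : LowerSet (Finset V)} {F : Finset V} {k : V}

omit [DecidableEq V] in
theorem IsFacet.deletion (hF : IsFacet Δ F) (hk : k ∉ F) : IsFacet (deletion Δ {k}) F :=
  ⟨⟨hF.1, Finset.disjoint_singleton_left.2 hk⟩, fun _ hG h => hF.2 hG.1 h⟩

theorem IsFacet.link (hF : IsFacet Δ F) (hk : k ∈ F) : IsFacet (link Δ {k}) (F.erase k) := by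
  refine ⟨⟨Δ.lower (Finset.erase_subset k F) hF.1, ?_, by simp⟩, fun G hG h => ?_⟩
  · rw [← Finset.insert_eq, Finset.insert_erase hk]
    exact hF.1
  · have h1 : F ⊆ {k} ∪ G := by
      rw [← Finset.insert_erase hk, ← Finset.insert_eq]
      exact Finset.insert_subset_insert k h
    intro x hx
    refine Finset.mem_erase.2 ⟨?_, hF.2 hG.2.1 h1 (Finset.mem_union_right _ hx)⟩
    rintro rfl
    exact Finset.disjoint_singleton_left.1 hG.2.2 hx

variable [Fintype V]

omit [DecidableEq V] in
theorem dim_eq_of_card_facets {c : ℕ} (h0 : ∅ ∈ Δ) (h : ∀ F, IsFacet Δ F → F.card = c) :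
    dim Δ = ((c - 1 : ℤ) : WithBot ℤ) := by
  classical
  refine le_antisymm (Finset.sup_le fun F hF => ?_) ?_
  · obtain ⟨G, hFG, hG⟩ := Set.Finite.exists_le_maximal (Set.toFinite {G | G ∈ Δ})
      (a := F) (by simpa using hF)
    have := Finset.card_le_card hFG
    rw [h G hG] at this
    exact WithBot.coe_le_coe.2 (by omega)
  · obtain ⟨G, -, hG⟩ := Set.Finite.exists_le_maximal (Set.toFinite {G | G ∈ Δ}) (a := ∅) h0
    rw [← h G hG]
    exact Finset.le_sup (f := faceDim) (Finset.mem_filter.2 ⟨Finset.mem_univ G, hG.1⟩)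

omit [DecidableEq V] in
theorem isPure_of_card_facets {c : ℕ} (h : ∀ F, IsFacet Δ F → F.card = c) : IsPure Δ := by
  intro F hF
  rw [dim_eq_of_card_facets (Δ.lower (Finset.empty_subset F) hF.1) h, faceDim, h F hF]

end Facets

/-! ### Vertex decomposability of the chain complex. -/

section ChainComplex

variable {M N : ℕ} {W : Finset (Fin M × Fin N)}

theorem hasChain_insert_iff {F : Finset (Fin M × Fin N)} {i : Fin M} {j : Fin N} {m : ℕ} :
    HasChain (insert (i, j) F) m j ↔ HasChain F m j := by
  refine ⟨fun h => ?_, HasChain.mono (Finset.subset_insert _ _)⟩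
  rw [hasChain_iff_exists] at h ⊢
  obtain ⟨c, hc, h⟩ := h
  refine ⟨c, hc, fun i' hi' => ⟨(h i' hi').1, ?_⟩⟩
  obtain ⟨hlt, v, hv, hv1, hv2⟩ := h i' hi'
  rcases Finset.mem_insert.1 hv with rfl | hv
  · exact absurd hv2 hlt.ne'
  · exact ⟨v, hv, hv1, hv2⟩

theorem not_hasChain_of_lt {F : Finset (Fin M × Fin N)} {m n : ℕ} (h : n < m) :
    ¬ HasChain F m n := by
  induction n generalizing m with
  | zero =>
    obtain ⟨m, rfl⟩ := Nat.exists_eq_add_one.2 h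
    exact not_hasChain_succ_zero F m
  | succ n ih =>
    obtain ⟨m, rfl⟩ := Nat.exists_eq_add_one.2 (n.succ_pos.trans h)
    exact fun hc => ih (Nat.lt_of_succ_lt_succ h) hc.pred

theorem hasChain_one_of_mem {F : Finset (Fin M × Fin N)} {v : Fin M × Fin N} {n : ℕ}
    (hv : v ∈ F) (h1 : v.1.val = 0) (h2 : v.2.val < n) : HasChain F 1 n :=
  (hasChain_iff_exists.2 ⟨fun _ => v.2, fun i j hij hj => by omega,
    fun i hi => ⟨h2, v, hv, by omega, rfl⟩⟩)

theorem chainComplex_zero (W : Finset (Fin M × Fin N)) (n : ℕ) : chainComplex W 0 n = ⊥ := by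
  ext F
  simp [chainComplex, hasChain_zero]

theorem chainComplex_of_lt (W : Finset (Fin M × Fin N)) {m n : ℕ} (h : n < m) :
    chainComplex W m n = LowerSet.Iic W := by
  ext F
  simp [chainComplex, not_hasChain_of_lt h]

theorem empty_mem_chainComplex (W : Finset (Fin M × Fin N)) (m n : ℕ) :
    ∅ ∈ chainComplex W (m + 1) n := by
  refine ⟨Finset.empty_subset _, fun h => ?_⟩
  obtain ⟨c, -, h⟩ := hasChain_iff_exists.1 h
  obtain ⟨-, v, hv, -⟩ := h 0 m.succ_pos
  simp at hv

theorem deletion_chainComplex (W : Finset (Fin M × Fin N)) (i : Fin M) (j : Fin N) :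
    deletion (chainComplex W (i + 1) (j + 1)) {(i, j)} =
      chainComplex (W.erase (i, j)) (i + 1) j := by
  ext F
  change ((F ⊆ W ∧ ¬ HasChain F (i + 1) (j + 1)) ∧ Disjoint {(i, j)} F) ↔
    (F ⊆ W.erase (i, j) ∧ ¬ HasChain F (i + 1) j)
  rw [Finset.disjoint_singleton_left, Finset.subset_erase, hasChain_succ_of_mem]
  tauto

theorem link_chainComplex {i : Fin M} {j : Fin N} (hk : (i, j) ∈ W) :
    link (chainComplex W (i + 1) (j + 1)) {(i, j)} = chainComplex (W.erase (i, j)) i j := by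
  ext F
  change ((F ⊆ W ∧ ¬ HasChain F (i + 1) (j + 1)) ∧
    ({(i, j)} ∪ F ⊆ W ∧ ¬ HasChain ({(i, j)} ∪ F) (i + 1) (j + 1)) ∧ Disjoint {(i, j)} F) ↔
    (F ⊆ W.erase (i, j) ∧ ¬ HasChain F i j)
  rw [Finset.disjoint_singleton_left, Finset.subset_erase, ← Finset.insert_eq]
  constructor
  · rintro ⟨⟨hF, -⟩, ⟨-, h2⟩, h3⟩
    exact ⟨⟨hF, h3⟩, fun hc => h2 (hasChain_succ_of_mem.2
      (.inr ⟨Finset.mem_insert_self _ _, hasChain_insert_iff.2 hc⟩))⟩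
  · rintro ⟨⟨hF, h3⟩, hc⟩
    exact ⟨⟨hF, fun h => hc h.pred⟩, ⟨Finset.insert_subset hk hF,
      fun h => hc (hasChain_insert_iff.1 h.pred)⟩, h3⟩

/-- A facet through the corner gives a facet of the link, with one element fewer; any other is a
facet of the deletion. The count is consistent with both. -/
theorem card_of_isFacet_chainComplex {m n : ℕ} (hm : m < M) (hn : n ≤ N) (hmn : m ≤ n)
    (hW : ∀ v : Fin M × Fin N, v.1.val ≤ m → v.2.val < n → v ∈ W) {F : Finset (Fin M × Fin N)}
    (hF : IsFacet (chainComplex W (m + 1) n) F) : F.card + n = W.card + m := by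
  induction n generalizing m W F with
  | zero =>
    rw [chainComplex_of_lt W (by omega)] at hF
    have : F = W := le_antisymm hF.1 (hF.2 (y := W) (LowerSet.mem_Iic_iff.2 le_rfl) hF.1)
    rw [this]
    omega
  | succ n ih =>
    rcases hmn.eq_or_lt with rfl | hmn
    · rw [chainComplex_of_lt W (by omega)] at hF
      have : F = W := le_antisymm hF.1 (hF.2 (y := W) (LowerSet.mem_Iic_iff.2 le_rfl) hF.1)
      rw [this]
    let i : Fin M := ⟨m, hm⟩
    let j : Fin N := ⟨n, hn⟩
    have hk : (i, j) ∈ W := hW _ le_rfl n.lt_succ_self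
    have hW' : ∀ v : Fin M × Fin N, v.1.val ≤ m → v.2.val < n → v ∈ W.erase (i, j) :=
      fun v h1 h2 => Finset.mem_erase.2
        ⟨fun h => h2.ne (congrArg (fun v => v.2.val) h), hW v h1 (h2.trans n.lt_succ_self)⟩
    have hcard := Finset.card_erase_add_one hk
    by_cases hkF : (i, j) ∈ F
    · have hcardF := Finset.card_erase_add_one hkF
      have h := hF.link hkF
      rw [link_chainComplex (i := i) (j := j) hk] at h
      cases m with
      | zero =>
        rw [show (i : ℕ) = 0 from rfl, chainComplex_zero] at h
        exact absurd h.1 (LowerSet.notMem_bot)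
      | succ m =>
        have := ih (m := m) (W := W.erase (i, j)) (by omega) (by omega) (by omega)
          (fun v h1 h2 => hW' v (by omega) h2) h
        omega
    · have h := hF.deletion hkF
      rw [deletion_chainComplex W i j] at h
      have := ih (m := m) (W := W.erase (i, j)) hm (by omega) (by omega) hW' h
      omega

theorem isVertexDecomposable_chainComplex {m n : ℕ} (hm : m ≤ M) (hn : n ≤ N)
    (hW : ∀ v : Fin M × Fin N, v.1.val < m → v.2.val < n → v ∈ W) :
    IsVertexDecomposable (chainComplex W m n) := by
  induction n generalizing m W with
  | zero => cases m with
    | zero => rw [chainComplex_zero]; exact .empty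
    | succ m => rw [chainComplex_of_lt W (by omega)]; exact .simplex W
  | succ n ih =>
    rcases lt_or_ge (n + 1) m with hlt | hle
    · rw [chainComplex_of_lt W hlt]; exact .simplex W
    cases m with
    | zero => rw [chainComplex_zero]; exact .empty
    | succ m =>
      let i : Fin M := ⟨m, hm⟩
      let j : Fin N := ⟨n, hn⟩
      have hk : (i, j) ∈ W := hW _ m.lt_succ_self n.lt_succ_self
      have hW' : ∀ v : Fin M × Fin N, v.1.val < m + 1 → v.2.val < n → v ∈ W.erase (i, j) :=
        fun v h1 h2 => Finset.mem_erase.2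
          ⟨fun h => h2.ne (congrArg (fun v => v.2.val) h), hW v h1 (h2.trans n.lt_succ_self)⟩
      have hdel := ih (m := m + 1) hm (by omega) hW'
      cases m with
      | zero =>
        -- With one row the corner alone is a chain, hence not a vertex: nothing is shed and the
        -- complex equals its deletion.
        have : chainComplex W 1 (n + 1) = chainComplex (W.erase (i, j)) 1 n := by
          have := deletion_chainComplex W i j
          rw [← this]
          ext F
          refine ⟨fun h => ⟨h, Finset.disjoint_singleton_left.2 fun hkF => ?_⟩, fun h => h.1⟩
          exact h.2 (hasChain_one_of_mem hkF rfl n.lt_succ_self)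
        rw [zero_add, this]
        exact hdel
      | succ m =>
        have hlink := ih (m := m + 1) (by omega) (by omega) fun v h1 h2 => hW' v (by omega) h2
        have hcard := Finset.card_erase_add_one hk
        have fd : ∀ F, IsFacet (chainComplex (W.erase (i, j)) (m + 2) n) F →
            F.card = W.card + m - n := fun F hF => by
          have := card_of_isFacet_chainComplex (m := m + 1) hm (by omega) (by omega)
            (fun v h1 h2 => hW' v (by omega) h2) hF
          omega
        have fl : ∀ F, IsFacet (chainComplex (W.erase (i, j)) (m + 1) n) F →
            F.card + 1 = W.card + m - n := fun F hF => by
          have := card_of_isFacet_chainComplex (m := m) (by omega) (by omega) (by omega)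
            (fun v h1 h2 => hW' v (by omega) h2) hF
          omega
        have ft : ∀ F, IsFacet (chainComplex W (m + 2) (n + 1)) F →
            F.card = W.card + m - n := fun F hF => by
          have := card_of_isFacet_chainComplex (m := m + 1) hm hn (by omega)
            (fun v h1 h2 => hW v (by omega) h2) hF
          omega
        have fl' : ∀ F, IsFacet (chainComplex (W.erase (i, j)) (m + 1) n) F →
            F.card = W.card + m - n - 1 := fun F hF => by
          have := fl F hF
          omega
        -- The facet sizes use truncated subtraction; positivity makes the final dimension count
        -- valid over ℤ.
        have hpos : 1 ≤ W.card + m - n := by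
          obtain ⟨F, -, hF⟩ := Set.Finite.exists_le_maximal
            (Set.toFinite {G | G ∈ chainComplex (W.erase (i, j)) (m + 1) n}) (a := ∅)
            (empty_mem_chainComplex _ m n)
          have := fl F hF
          omega
        have ed := deletion_chainComplex W i j
        have el := link_chainComplex (W := W) (i := i) (j := j) hk
        refine .step _ (i, j) ⟨by simpa using hk, fun h => ?_⟩ (el ▸ isPure_of_card_facets fl')
          (ed ▸ isPure_of_card_facets fd) (el ▸ hlink) (ed ▸ hdel) ?_ ?_
        · obtain ⟨c, -, h⟩ := hasChain_iff_exists.1 h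
          obtain ⟨-, v, hv, hv', -⟩ := h 0 (by omega)
          rw [Finset.mem_singleton.1 hv] at hv'
          simp [i] at hv'
        · have h1 := dim_eq_of_card_facets (empty_mem_chainComplex W (m + 1) (n + 1)) ft
          have h2 := dim_eq_of_card_facets (empty_mem_chainComplex (W.erase (i, j)) (m + 1) n) fd
          exact (h1.trans h2.symm).trans (congrArg dim ed.symm)
        · have h1 := dim_eq_of_card_facets (empty_mem_chainComplex W (m + 1) (n + 1)) ft
          have h2 := dim_eq_of_card_facets (empty_mem_chainComplex (W.erase (i, j)) m n) fl'
          have e : dim (link (chainComplex W (m + 1 + 1) (n + 1)) {(i, j)}) =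
            dim (chainComplex (W.erase (i, j)) (m + 1) n) := congrArg dim el
          rw [e, h1, h2, ← WithBot.coe_one, ← WithBot.coe_add]
          exact congrArg _ (by omega)

end ChainComplex

/-! ### Finite projectivity from the colon sequence. -/

section ProjectiveExtension

variable {A S : Type*} [CommRing A] [CommRing S] [Algebra A S]

theorem finite_projective_of_exact {M₁ M₂ M₃ : Type*} [AddCommGroup M₁] [AddCommGroup M₂]
    [AddCommGroup M₃] [Module A M₁] [Module A M₂] [Module A M₃] {f : M₁ →ₗ[A] M₂}
    {g : M₂ →ₗ[A] M₃} (h : Function.Exact f g) (hf : Function.Injective f)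
    (hg : Function.Surjective g) (h₁ : Module.Finite A M₁ ∧ Module.Projective A M₁)
    (h₃ : Module.Finite A M₃ ∧ Module.Projective A M₃) :
    Module.Finite A M₂ ∧ Module.Projective A M₂ := by
  have := h₁.1
  have := h₁.2
  have := h₃.1
  have := h₃.2
  obtain ⟨s, hs⟩ := Module.projective_lifting_property g LinearMap.id hg
  have e := (h.splitSurjectiveEquiv hf ⟨s, hs⟩).1.symm
  exact ⟨Module.Finite.equiv e, Module.Projective.of_equiv e⟩

/-- If `S / (I : x)` and `S / (I + (x))` are finite projective over `A`, then so is `S / I`. -/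
theorem finite_projective_quotient_of_colon {I J : Ideal S} {x : S}
    (hJ : ∀ f, f ∈ J ↔ x * f ∈ I)
    (h₁ : Module.Finite A (S ⧸ J) ∧ Module.Projective A (S ⧸ J))
    (h₃ : Module.Finite A (S ⧸ (I ⊔ Ideal.span {x})) ∧
      Module.Projective A (S ⧸ (I ⊔ Ideal.span {x}))) :
    Module.Finite A (S ⧸ I) ∧ Module.Projective A (S ⧸ I) := by
  let f : (S ⧸ J) →ₗ[A] S ⧸ I :=
    (Submodule.mapQ J I (LinearMap.mulLeft S x) fun y hy => (hJ y).1 hy).restrictScalars A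
  let g : (S ⧸ I) →ₗ[A] S ⧸ (I ⊔ Ideal.span {x}) :=
    (Ideal.Quotient.factorₐ A (le_sup_left : I ≤ I ⊔ Ideal.span {x})).toLinearMap
  have hf : ∀ y, f (Ideal.Quotient.mk J y) = Ideal.Quotient.mk I (x * y) := fun _ => rfl
  have hg : ∀ y, g (Ideal.Quotient.mk I y) = Ideal.Quotient.mk _ y := fun _ => rfl
  refine finite_projective_of_exact (f := f) (g := g) (fun y => ?_) ?_ ?_ h₁ h₃
  · obtain ⟨y, rfl⟩ := Ideal.Quotient.mk_surjective y
    rw [hg, Ideal.Quotient.eq_zero_iff_mem]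
    constructor
    · intro hy
      obtain ⟨a, ha, b, hb, rfl⟩ := Submodule.mem_sup.1 hy
      obtain ⟨c, rfl⟩ := Ideal.mem_span_singleton'.1 hb
      refine ⟨Ideal.Quotient.mk J c, ?_⟩
      rw [hf, map_add, Ideal.Quotient.eq_zero_iff_mem.2 ha, zero_add, mul_comm]
    · rintro ⟨z, hz⟩
      obtain ⟨z, rfl⟩ := Ideal.Quotient.mk_surjective z
      rw [hf, Ideal.Quotient.eq] at hz
      rw [← sub_sub_cancel (x * z) y]
      exact sub_mem (Ideal.mul_mem_right _ _ (Ideal.mem_sup_right (Ideal.mem_span_singleton_self x)))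
        (Ideal.mem_sup_left hz)
  · rw [injective_iff_map_eq_zero]
    intro z hz
    obtain ⟨z, rfl⟩ := Ideal.Quotient.mk_surjective z
    rw [hf, Ideal.Quotient.eq_zero_iff_mem, ← hJ] at hz
    exact Ideal.Quotient.eq_zero_iff_mem.2 hz
  · exact Ideal.Quotient.factor_surjective le_sup_left

end ProjectiveExtension

/-! ### Regular sequences of monic polynomials. -/

section RegularSequences

open RingTheory.Sequence

theorem isWeaklyRegular_map_ringEquiv {R S : Type*} [CommRing R] [CommRing S] (e : R ≃+* S)
    {rs : List R} (h : IsWeaklyRegular R rs) : IsWeaklyRegular S (rs.map e) := by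
  refine (e.toAddEquiv.isWeaklyRegular_congr ?_).1 h
  exact List.forall₂_map_right_iff.2 (List.forall₂_same.2 fun r _ x => map_mul e r x)

theorem isWeaklyRegular_cons_map {C S : Type*} [CommRing C] [CommRing S] [Algebra C S]
    {rs : List C} (h : IsWeaklyRegular C rs) {s : S} (hs : IsSMulRegular S s)
    [Module.Flat C (QuotSMulTop s S)] : IsWeaklyRegular S (s :: rs.map (algebraMap C S)) := by
  rw [isWeaklyRegular_cons_iff, isWeaklyRegular_map_algebraMap_iff]
  refine ⟨hs, ?_⟩
  exact ((TensorProduct.rid C (QuotSMulTop s S)).isWeaklyRegular_congr rs).1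
    h.isWeaklyRegular_lTensor

/-- The quotient by a monic polynomial is free over the coefficient ring, so a regular sequence of
coefficients stays regular on it. -/
theorem isWeaklyRegular_cons_map_C {C : Type*} [CommRing C] {rs : List C}
    (h : IsWeaklyRegular C rs) {g : Polynomial C} (hg : g.Monic) :
    IsWeaklyRegular (Polynomial C) (g :: rs.map (algebraMap C (Polynomial C))) := by
  have : Module.Free C (Polynomial C ⧸ Ideal.span {g}) := hg.free_quotient
  let e : QuotSMulTop g (Polynomial C) ≃ₗ[Polynomial C] Polynomial C ⧸ Ideal.span {g} :=
    Submodule.quotEquivOfEq _ _ (by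
      rw [← Submodule.ideal_span_singleton_smul, smul_eq_mul, Ideal.mul_top])
  have : Module.Flat C (QuotSMulTop g (Polynomial C)) :=
    Module.Flat.of_linearEquiv (e.restrictScalars C)
  exact isWeaklyRegular_cons_map h fun a b hab => hg.isRegular.left hab

/-- Monic univariate polynomials in distinct variables form a regular sequence. -/
theorem exists_isWeaklyRegular_of_monic (B : Type*) [CommRing B] (E : Type*) [Finite E]
    (g : E → Polynomial B) (hg : ∀ e, (g e).Monic) :
    ∃ rs : List (MvPolynomial E B), rs.length = Nat.card E ∧
      IsWeaklyRegular (MvPolynomial E B) rs ∧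
        ∀ r ∈ rs, ∃ e, r = Polynomial.aeval (X e) (g e) := by
  induction E using Finite.induction_empty_option with
  | of_equiv e ih =>
    obtain ⟨rs, h1, h2, h3⟩ := ih (fun i => g (e i)) (fun i => hg (e i))
    refine ⟨rs.map (renameEquiv B e).toRingEquiv, ?_, isWeaklyRegular_map_ringEquiv _ h2, ?_⟩
    · rw [List.length_map, h1, Nat.card_congr e]
    · intro r hr
      obtain ⟨r', hr', rfl⟩ := List.mem_map.1 hr
      obtain ⟨i, rfl⟩ := h3 r' hr'
      refine ⟨e i, ?_⟩
      change rename e _ = _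
      rw [← Polynomial.aeval_algHom_apply, rename_X]
  | h_empty => exact ⟨[], by simp, .nil _ _, by simp⟩
  | @h_option E _ ih =>
    obtain ⟨rs, h1, h2, h3⟩ := ih (fun i => g (some i)) (fun i => hg (some i))
    let e := (optionEquivLeft B E).symm
    refine ⟨List.map e.toRingEquiv ((g none).map (algebraMap B (MvPolynomial E B)) ::
        rs.map (algebraMap (MvPolynomial E B) (Polynomial (MvPolynomial E B)))), ?_,
      isWeaklyRegular_map_ringEquiv _ (isWeaklyRegular_cons_map_C h2 ((hg none).map _)), ?_⟩
    · simp [h1]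
    · have e_C : ∀ p : MvPolynomial E B, e (Polynomial.C p) = rename some p := fun p => by
        rw [AlgEquiv.symm_apply_eq, optionEquivLeft_apply, aeval_rename]
        have : (fun o : Option E => o.elim Polynomial.X fun s => Polynomial.C (X s)) ∘ some =
          fun s => (Polynomial.CAlgHom (R := B) (A := MvPolynomial E B)) (X s) := rfl
        rw [this, ← comp_aeval_apply, aeval_X_left_apply]
        rfl
      intro r hr
      rw [List.map_cons, List.mem_cons] at hr
      rcases hr with rfl | hr
      · refine ⟨none, ?_⟩
        change e _ = _
        rw [AlgEquiv.symm_apply_eq, ← AlgEquiv.coe_toAlgHom, ← Polynomial.aeval_algHom_apply,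
          AlgEquiv.coe_toAlgHom, optionEquivLeft_X_none, Polynomial.aeval_X_left_eq_map]
      · simp only [List.map_map, List.mem_map, Function.comp] at hr
        obtain ⟨r, hr, rfl⟩ := hr
        obtain ⟨i, rfl⟩ := h3 r hr
        refine ⟨some i, ?_⟩
        refine (e_C _).trans ?_
        rw [← Polynomial.aeval_algHom_apply, rename_X]

end RegularSequences

/-! ### Finite flat algebras over polynomial rings. -/

section CohenMacaulay

open RingTheory.Sequence

theorem ringKrullDim_le_of_isIntegral (A R : Type*) [CommRing A] [CommRing R] [Algebra A R]
    [Algebra.IsIntegral A R] : ringKrullDim R ≤ ringKrullDim A :=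
  Order.krullDim_le_of_strictMono (PrimeSpectrum.comap (algebraMap A R)) fun _ _ h =>
    Ideal.IsIntegral.comap_lt_comap h

/-- A ring that is finite and flat over a polynomial ring over a field is Cohen-Macaulay. -/
theorem isCohenMacaulayRing_of_finite_of_flat (K E R : Type*) [Field K] [Finite E] [CommRing R]
    [Algebra (MvPolynomial E K) R] [Module.Finite (MvPolynomial E K) R]
    [Module.Flat (MvPolynomial E K) R] : IsCohenMacaulayRing R := by
  have hN : IsNoetherianRing R := IsNoetherianRing.of_finite (MvPolynomial E K) R
  refine ⟨hN, fun P hP => ?_⟩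
  let A := MvPolynomial E K
  let p : Ideal A := P.comap (algebraMap A R)
  have hp : p.IsMaximal := Ideal.isMaximal_comap_of_isIntegral_of_isMaximal P
  let _ : Field (A ⧸ p) := Ideal.Quotient.field p
  have : Module.Finite K (A ⧸ p) := finite_of_finite_type_of_isJacobsonRing K (A ⧸ p)
  -- The residue field at `p` is finite over `K`. The minimal polynomials of the coordinates,
  -- evaluated at the variables, form a regular sequence in `p` of length equal to the dimension of
  -- the polynomial ring.
  let g : E → Polynomial K := fun e => minpoly K (Ideal.Quotient.mk p (X e))
  obtain ⟨rs, hlen, hreg, hmem⟩ := exists_isWeaklyRegular_of_monic K E g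
    fun e => minpoly.monic (Algebra.IsIntegral.isIntegral _)
  have hrs : ∀ r ∈ rs.map (algebraMap A R), r ∈ P := by
    intro r hr
    obtain ⟨q, hq, rfl⟩ := List.mem_map.1 hr
    obtain ⟨e, rfl⟩ := hmem q hq
    change _ ∈ p
    rw [← Ideal.Quotient.eq_zero_iff_mem, ← Ideal.Quotient.mkₐ_eq_mk K,
      ← Polynomial.aeval_algHom_apply]
    exact minpoly.aeval K _
  have hregR : IsWeaklyRegular R (rs.map (algebraMap A R)) := hreg.of_flat
  have hregP := hregR.isRegular_of_isLocalization_of_mem (Localization.AtPrime P) P hrs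
  refine ⟨_, fun r hr => ?_, hregP, le_antisymm ?_ ?_⟩
  · obtain ⟨q, hq, rfl⟩ := List.mem_map.1 hr
    exact (IsLocalization.AtPrime.to_map_mem_maximal_iff _ P _).2 (hrs q hq)
  · rw [← ringKrullDim_add_length_eq_ringKrullDim_of_isRegular _ hregP]
    have : Nontrivial (Localization.AtPrime P ⧸ Ideal.ofList
        ((rs.map (algebraMap A R)).map (algebraMap R (Localization.AtPrime P)))) := by
      refine Ideal.Quotient.nontrivial_iff.2 fun h => hregP.top_ne_smul ?_
      rw [h, smul_eq_mul, Ideal.mul_top]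
    exact le_add_of_nonneg_left ringKrullDim_nonneg_of_nontrivial
  -- dim R_P = ht P ≤ dim R ≤ dim A by integrality, and dim A is the length of the sequence.
  · rw [IsLocalization.AtPrime.ringKrullDim_eq_height P]
    refine (Ideal.height_le_ringKrullDim_of_ne_top hP.ne_top).trans ?_
    refine (ringKrullDim_le_of_isIntegral A R).trans ?_
    rw [MvPolynomial.ringKrullDim_of_isNoetherianRing, ringKrullDim_eq_zero_of_field, zero_add]
    simp [hlen]

end CohenMacaulay

/-! ### Colon by a variable and sum with a variable. -/

section Ideals

variable {V K : Type*} [Field K] [DecidableEq V]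

theorem mem_stanleyReisnerIdeal_iff_X_mul_mem {Δ Δ' : LowerSet (Finset V)} {k : V}
    (h : ∀ F, F ∈ Δ' ↔ insert k F ∈ Δ) (f : MvPolynomial V K) :
    f ∈ stanleyReisnerIdeal K Δ' ↔ X k * f ∈ stanleyReisnerIdeal K Δ := by
  rw [mem_stanleyReisnerIdeal, mem_stanleyReisnerIdeal, support_X_mul]
  simp only [Finset.mem_map, forall_exists_index, and_imp, forall_apply_eq_imp_iff₂]
  refine forall₂_congr fun d _ => ?_
  have : (addLeftEmbedding (Finsupp.single k 1) d).support = insert k d.support := by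
    ext v
    by_cases hv : v = k <;> simp [hv]
  rw [this, h]

theorem stanleyReisnerIdeal_sup_span_X (Δ : LowerSet (Finset V)) (k : V) :
    stanleyReisnerIdeal K Δ ⊔ Ideal.span {X k} = stanleyReisnerIdeal K (deletion Δ {k}) := by
  refine le_antisymm (sup_le (Ideal.span_le.2 ?_) (Ideal.span_le.2 ?_)) (Ideal.span_le.2 ?_)
  · rintro _ ⟨F, hF, rfl⟩
    exact sqfreeMonomial_mem_stanleyReisnerIdeal.2 fun h => hF h.1
  · rintro _ rfl
    have : (X k : MvPolynomial V K) = sqfreeMonomial K {k} := by simp [sqfreeMonomial]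
    rw [this, SetLike.mem_coe, sqfreeMonomial_mem_stanleyReisnerIdeal]
    exact fun h => Finset.disjoint_singleton_left.1 h.2 (Finset.mem_singleton_self k)
  · rintro _ ⟨F, hF, rfl⟩
    by_cases hk : k ∈ F
    · refine Ideal.mem_sup_right (Ideal.mem_span_singleton.2 ?_)
      exact Finset.dvd_prod_of_mem X hk
    · refine Ideal.mem_sup_left (sqfreeMonomial_mem_stanleyReisnerIdeal.2 fun h => hF ⟨h, ?_⟩)
      exact Finset.disjoint_singleton_left.2 hk

end Ideals

/-! ### Differences of variables as parameters: the case of a simplex. -/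

section Differences

variable {V : Type*} [DecidableEq V] (K : Type*) [Field K] (D : V → Prop) [DecidablePred D]
  (base : V → V)

/-- The parameters attached to the classes (the fibres of `base`) on the set `D` of vertices:
the differences between the variables of a class and its base variable, and the variables outside
of the classes. -/
def classParam (v : V) : MvPolynomial V K :=
  if D v then X v - X (base v) else X v

/-- The vertices whose parameter is not zero by definition. -/
abbrev NonBase : Type _ := {v : V // ¬ (D v ∧ base v = v)}

/-- The polynomial ring as an algebra over the polynomial ring of the parameters. -/
abbrev paramAlgebra : Algebra (MvPolynomial (NonBase D base) K) (MvPolynomial V K) :=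
  (aeval fun e : NonBase D base => classParam K D base e).toRingHom.toAlgebra

variable {D base}

/-- If `T` meets each class exactly once, then modulo the variables of `T` the polynomial ring
is the polynomial ring of the parameters. -/
theorem finite_projective_quotient_simplex (hD : ∀ v, D v → D (base v))
    (hbase : ∀ v, base (base v) = base v) {W : Finset V} (hW : ∀ v, v ∉ W → D v)
    (hT : ∀ v, D v → ∃! t, t ∉ W ∧ base t = base v) :
    letI := paramAlgebra K D base
    Module.Finite (MvPolynomial (NonBase D base) K)
        (MvPolynomial V K ⧸ stanleyReisnerIdeal K (LowerSet.Iic W)) ∧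
      Module.Projective (MvPolynomial (NonBase D base) K)
        (MvPolynomial V K ⧸ stanleyReisnerIdeal K (LowerSet.Iic W)) := by
  let _ := paramAlgebra K D base
  let A := MvPolynomial (NonBase D base) K
  set I := stanleyReisnerIdeal K (LowerSet.Iic W) with hI
  have hX : ∀ v, v ∉ W → X v ∈ I := fun v hv => by
    have : (X v : MvPolynomial V K) = sqfreeMonomial K {v} := by simp [sqfreeMonomial]
    rw [this, hI, sqfreeMonomial_mem_stanleyReisnerIdeal]
    simpa using hv
  choose! t ht htu using hT
  let y : V → A := fun v => if h : D v ∧ base v = v then 0 else X ⟨v, h⟩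
  -- The inverse modulo `I`: in each class the variable of the representative `t v` in the
  -- complement of `W` is zero, so `X v` is the difference of the parameters of `v` and `t v`.
  let ψ : MvPolynomial V K →ₐ[K] A := aeval fun v => if D v then y v - y (t v) else y v
  have ht_base : ∀ v, D v → t (base v) = t v := fun v hv => by
    refine htu v hv _ ⟨(ht _ (hD v hv)).1, ?_⟩
    rw [(ht _ (hD v hv)).2, hbase]
  have hψ : ∀ f ∈ I, ψ f = 0 := by
    have : I ≤ RingHom.ker ψ.toRingHom := by
      refine Ideal.span_le.2 ?_
      rintro _ ⟨F, hF, rfl⟩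
      obtain ⟨v, hv, hvW⟩ := Finset.not_subset.1 (fun h => hF (LowerSet.mem_Iic_iff.2 h))
      change ψ _ = 0
      rw [sqfreeMonomial, map_prod]
      refine Finset.prod_eq_zero hv ?_
      have : v = t v := htu v (hW v hvW) v ⟨hvW, rfl⟩
      simp only [ψ, aeval_X, hW v hvW, if_true, ← this, sub_self]
    exact fun f hf => this hf
  have hy_base : ∀ v, D v → y (base v) = 0 := fun v hv => dif_pos ⟨hD v hv, hbase v⟩
  have hψA : ∀ a : A, ψ (algebraMap A (MvPolynomial V K) a) = a := by
    intro a
    change (ψ.comp (aeval fun e : NonBase D base => classParam K D base e)) a = AlgHom.id K A a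
    congr 1
    refine algHom_ext fun e => ?_
    have hye : y e = X e := dif_neg e.2
    change _ = X e
    simp only [AlgHom.comp_apply, aeval_X, classParam]
    split_ifs with he
    · simp only [map_sub, ψ, aeval_X, he, hD _ he, if_true, hy_base _ he, ht_base _ he, hye]
      rw [zero_sub, sub_neg_eq_add, sub_add_cancel]
    · simp only [ψ, aeval_X, he, if_false, hye]
  have hmap : ∀ v, algebraMap A (MvPolynomial V K) (y v) = classParam K D base v := by
    intro v
    by_cases h : D v ∧ base v = v
    · simp only [y, dif_pos h, map_zero, classParam, h.1, h.2, if_true, sub_self]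
    · simp only [y, dif_neg h]
      exact aeval_X _ _
  have hinj : Function.Injective (Algebra.linearMap A (MvPolynomial V K ⧸ I)) := by
    rw [injective_iff_map_eq_zero]
    intro a ha
    rw [← hψA a]
    exact hψ _ (Ideal.Quotient.eq_zero_iff_mem.1 ha)
  have hsurj : Function.Surjective (Algebra.linearMap A (MvPolynomial V K ⧸ I)) := by
    have key : ∀ f, Ideal.Quotient.mk I f = Ideal.Quotient.mk I (algebraMap A _ (ψ f)) := by
      let q := Ideal.Quotient.mkₐ K I
      let φ : A →ₐ[K] MvPolynomial V K := aeval fun e : NonBase D base => classParam K D base e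
      have : q = (q.comp φ).comp ψ := by
        refine algHom_ext fun v => ?_
        change Ideal.Quotient.mk I (X v) = Ideal.Quotient.mk I (algebraMap A _ (ψ (X v)))
        simp only [ψ, aeval_X]
        split_ifs with hv
        · have htv := ht v hv
          rw [map_sub, hmap, hmap, classParam, classParam, if_pos hv, if_pos (hW _ htv.1), htv.2,
            sub_sub_sub_cancel_right, map_sub, Ideal.Quotient.eq_zero_iff_mem.2 (hX _ htv.1),
            sub_zero]
        · rw [hmap, classParam, if_neg hv]
      exact fun f => DFunLike.congr_fun this f
    intro z
    obtain ⟨f, rfl⟩ := Ideal.Quotient.mk_surjective z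
    exact ⟨ψ f, (key f).symm⟩
  let e := LinearEquiv.ofBijective _ ⟨hinj, hsurj⟩
  exact ⟨Module.Finite.equiv e, Module.Projective.of_equiv e⟩

end Differences

/-! ### Cohen–Macaulayness via full diagonals. -/

section Diagonals

variable {m n : ℕ}

/-- The cell lies on a full diagonal of the `m × n` matrix. -/
def OnFullDiagonal (v : Fin m × Fin n) : Prop :=
  v.1.val ≤ v.2.val ∧ v.2.val + m ≤ n + v.1.val

instance : DecidablePred (OnFullDiagonal (m := m) (n := n)) := fun _ =>
  inferInstanceAs (Decidable (_ ∧ _))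

/-- The first cell of the diagonal of a cell. -/
def diagBase (v : Fin m × Fin n) : Fin m × Fin n :=
  (⟨0, v.1.pos⟩, ⟨v.2 - v.1, (Nat.sub_le _ _).trans_lt v.2.2⟩)

theorem diagBase_diagBase (v : Fin m × Fin n) : diagBase (diagBase v) = diagBase v := rfl

theorem OnFullDiagonal.diagBase {v : Fin m × Fin n} (hv : OnFullDiagonal v) :
    OnFullDiagonal (diagBase v) := by
  unfold OnFullDiagonal MaxMinors.diagBase at *
  simp only
  omega

theorem diagBase_eq_iff {v w : Fin m × Fin n} (hv : OnFullDiagonal v) (hw : OnFullDiagonal w) :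
    diagBase v = diagBase w ↔ v.2.val + w.1.val = w.2.val + v.1.val := by
  unfold OnFullDiagonal at hv hw
  simp only [MaxMinors.diagBase, Prod.mk.injEq, Fin.mk.injEq, true_and]
  omega

/-- Describes the star of the corner rather than its link: `W` keeps the corner because the colon
ideal does not kill its variable. -/
theorem insert_mem_chainComplex_iff {M N : ℕ} {W F : Finset (Fin M × Fin N)} {i : Fin M}
    {j : Fin N} (hk : (i, j) ∈ W) :
    F ∈ chainComplex W i j ↔ insert (i, j) F ∈ chainComplex W (i + 1) (j + 1) := by
  rw [mem_chainComplex, mem_chainComplex, Finset.insert_subset_iff]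
  refine and_congr (by simp [hk]) (not_congr ⟨fun h => ?_, fun h => ?_⟩)
  · exact hasChain_succ_of_mem.2
      (.inr ⟨Finset.mem_insert_self _ _, hasChain_insert_iff.2 h⟩)
  · exact hasChain_insert_iff.1 h.pred

variable (K : Type*) [Field K]

/-- The invariant: the cells already removed represent exactly once each full diagonal strictly to
the right of the one of offset q - p, which carries the current corner. The colon step keeps q - p
and `W`; the deletion step lowers q - p by one and removes the corner. Once q < p, every full
diagonal is represented and the complex is a simplex. -/
theorem finite_projective_quotient_chainComplex {p q : ℕ} (hp : p ≤ m) (hq : q ≤ n)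
    (hpq : q + m ≤ n + p) {W : Finset (Fin m × Fin n)}
    (hW : ∀ v, v ∉ W → OnFullDiagonal v ∧ q + v.1.val < v.2.val + p)
    (hT : ∀ v : Fin m × Fin n, OnFullDiagonal v → q + v.1.val < v.2.val + p →
      ∃! t, t ∉ W ∧ diagBase t = diagBase v) :
    letI := paramAlgebra K (OnFullDiagonal (m := m) (n := n)) diagBase
    Module.Finite (MvPolynomial (NonBase (OnFullDiagonal (m := m) (n := n)) diagBase) K)
        (MvPolynomial (Fin m × Fin n) K ⧸ stanleyReisnerIdeal K (chainComplex W p q)) ∧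
      Module.Projective (MvPolynomial (NonBase (OnFullDiagonal (m := m) (n := n)) diagBase) K)
        (MvPolynomial (Fin m × Fin n) K ⧸ stanleyReisnerIdeal K (chainComplex W p q)) := by
  let _ := paramAlgebra K (OnFullDiagonal (m := m) (n := n)) diagBase
  have zero_case : ∀ (q : ℕ) (W : Finset (Fin m × Fin n)),
      Module.Finite (MvPolynomial (NonBase (OnFullDiagonal (m := m) (n := n)) diagBase) K)
        (MvPolynomial (Fin m × Fin n) K ⧸ stanleyReisnerIdeal K (chainComplex W 0 q)) ∧
      Module.Projective (MvPolynomial (NonBase (OnFullDiagonal (m := m) (n := n)) diagBase) K)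
        (MvPolynomial (Fin m × Fin n) K ⧸ stanleyReisnerIdeal K (chainComplex W 0 q)) := by
    intro q W
    have : stanleyReisnerIdeal K (chainComplex W 0 q) = ⊤ := by
      rw [Ideal.eq_top_iff_one, chainComplex_zero, mem_stanleyReisnerIdeal]
      exact fun d _ => LowerSet.notMem_bot
    have : Subsingleton
        (MvPolynomial (Fin m × Fin n) K ⧸ stanleyReisnerIdeal K (chainComplex W 0 q)) :=
      Ideal.Quotient.subsingleton_iff.2 this
    exact ⟨inferInstance, inferInstance⟩
  have simplex_case : ∀ {p q : ℕ} {W : Finset (Fin m × Fin n)}, q < p →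
      (∀ v, v ∉ W → OnFullDiagonal v ∧ q + v.1.val < v.2.val + p) →
      (∀ v : Fin m × Fin n, OnFullDiagonal v → q + v.1.val < v.2.val + p →
        ∃! t, t ∉ W ∧ diagBase t = diagBase v) →
      Module.Finite (MvPolynomial (NonBase (OnFullDiagonal (m := m) (n := n)) diagBase) K)
        (MvPolynomial (Fin m × Fin n) K ⧸ stanleyReisnerIdeal K (chainComplex W p q)) ∧
      Module.Projective (MvPolynomial (NonBase (OnFullDiagonal (m := m) (n := n)) diagBase) K)
        (MvPolynomial (Fin m × Fin n) K ⧸ stanleyReisnerIdeal K (chainComplex W p q)) := by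
    intro p q W hlt hW hT
    rw [chainComplex_of_lt W hlt]
    refine finite_projective_quotient_simplex K (fun _ h => h.diagBase) diagBase_diagBase
      (fun v hv => (hW v hv).1) fun v hv => hT v hv ?_
    have := hv.1
    omega
  induction q generalizing p W with
  | zero => cases p with
    | zero => exact zero_case _ _
    | succ p => exact simplex_case p.succ_pos hW hT
  | succ q ih =>
    rcases lt_or_ge (q + 1) p with hlt | hle
    · exact simplex_case hlt hW hT
    cases p with
    | zero => exact zero_case _ _
    | succ p =>
      let i : Fin m := ⟨p, hp⟩
      let j : Fin n := ⟨q, hq⟩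
      have hkD : OnFullDiagonal (i, j) :=
        ⟨Nat.le_of_succ_le_succ hle, show q + m ≤ n + p by omega⟩
      have hk : (i, j) ∈ W := by
        by_contra h
        have : q + 1 + p < q + (p + 1) := (hW _ h).2
        omega
      refine finite_projective_quotient_of_colon (x := X (i, j))
        (mem_stanleyReisnerIdeal_iff_X_mul_mem fun F =>
          insert_mem_chainComplex_iff (i := i) (j := j) hk) ?_ ?_
      · refine ih (p := p) (by omega) (by omega) (by omega) (fun v hv => ?_) fun v hv h =>
          hT v hv (by omega)
        have := hW v hv
        exact ⟨this.1, by omega⟩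
      · rw [stanleyReisnerIdeal_sup_span_X, deletion_chainComplex W i j]
        refine ih (p := p + 1) hp (by omega) (by omega) (fun v hv => ?_) fun v hv h => ?_
        · rw [Finset.mem_erase, not_and_or, not_not] at hv
          rcases hv with rfl | hv
          · exact ⟨hkD, show q + p < q + (p + 1) by omega⟩
          · have := hW v hv
            exact ⟨this.1, by omega⟩
        · by_cases hold : q + 1 + v.1.val < v.2.val + (p + 1)
          · obtain ⟨t, ⟨ht, htb⟩, htu⟩ := hT v hv hold
            refine ⟨t, ⟨fun h => ht (Finset.mem_of_mem_erase h), htb⟩, fun s ⟨hs, hsb⟩ => ?_⟩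
            refine htu s ⟨fun h => hs (Finset.mem_erase.2 ⟨?_, h⟩), hsb⟩
            rintro rfl
            have : q + v.1.val = v.2.val + p := (diagBase_eq_iff hkD hv).1 hsb
            omega
          -- The diagonal of the corner is the only new one. Earlier removed cells lie strictly to
          -- its right, so the corner is its unique representative.
          · refine ⟨(i, j), ⟨Finset.notMem_erase _ _, (diagBase_eq_iff hkD hv).2 ?_⟩,
              fun s ⟨hs, hsb⟩ => ?_⟩
            · change q + v.1.val = v.2.val + p
              omega
            · by_contra hne
              have hsW : s ∉ W := fun h => hs (Finset.mem_erase.2 ⟨hne, h⟩)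
              have h1 := hW s hsW
              have h2 := (diagBase_eq_iff h1.1 hv).1 hsb
              omega

theorem isCohenMacaulayIdeal_chainComplex (m n : ℕ) :
    IsCohenMacaulayIdeal (stanleyReisnerIdeal K
      (chainComplex (Finset.univ : Finset (Fin m × Fin n)) m n)) := by
  let _ := paramAlgebra K (OnFullDiagonal (m := m) (n := n)) diagBase
  -- At the start the offset n - m is that of the last full diagonal: nothing lies to its right,
  -- matching an empty set of removed cells.
  obtain ⟨h1, h2⟩ := finite_projective_quotient_chainComplex K (m := m) (n := n) le_rfl le_rfl
    le_rfl (W := Finset.univ) (by simp) fun v hv h => by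
      have := hv.2
      omega
  exact isCohenMacaulayRing_of_finite_of_flat K
    (NonBase (OnFullDiagonal (m := m) (n := n)) diagBase) _

end Diagonals
end MaxMinors
end

theorem theorem2p1 {K : Type*} [Field K] (m n : ℕ) (hm : 1 ≤ m) (hmn : m ≤ n)
    (σ : MonomialOrder (Fin m × Fin n)) (hσ : MaxMinors.IsDiagonal K σ) :
    MaxMinors.IsReducedGroebnerBasis σ (MaxMinors.minors m n K m)
        (MaxMinors.minorsIdeal m n K m) ∧
    MaxMinors.IsSquarefreeMonomialIdeal
        (MaxMinors.initialIdeal σ (MaxMinors.minorsIdeal m n K m)) ∧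
    MaxMinors.IsCohenMacaulayIdeal
        (MaxMinors.initialIdeal σ (MaxMinors.minorsIdeal m n K m)) ∧
    (∃! Δ : LowerSet (Finset (Fin m × Fin n)),
      MaxMinors.stanleyReisnerIdeal K Δ =
        MaxMinors.initialIdeal σ (MaxMinors.minorsIdeal m n K m)) ∧
    ∀ Δ : LowerSet (Finset (Fin m × Fin n)),
      MaxMinors.stanleyReisnerIdeal K Δ =
          MaxMinors.initialIdeal σ (MaxMinors.minorsIdeal m n K m) →
        MaxMinors.IsVertexDecomposable Δ := by
  refine ⟨MaxMinors.isReducedGroebnerBasis_minors hσ, ?_⟩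
  rw [MaxMinors.initialIdeal_minorsIdeal hσ]
  refine ⟨⟨_, MaxMinors.stanleyReisnerIdeal_eq_span_image _⟩,
    MaxMinors.isCohenMacaulayIdeal_chainComplex K m n,
    ⟨_, rfl, fun Δ h => MaxMinors.stanleyReisnerIdeal_injective h⟩, fun Δ h => ?_⟩
  rw [MaxMinors.stanleyReisnerIdeal_injective h]
  exact MaxMinors.isVertexDecomposable_chainComplex le_rfl le_rfl fun v _ _ => Finset.mem_univ v
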